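/- A (finite) geometric polyhedron $P$ in Euclidean space $\mathbb{E}^3$ consists of a finite set of points (vertices), a set of line segments joining vertices (edges), and a set of polygons made up of these edges (faces; a polygon has $n\ge 3$ distinct vertices and is the closed edge path through them), such that the edge graph is connected, the vertex-figure at every vertex $v$ (the graph on the neighbours of $v$ in which $u,w$ are joined when $uv$ and $vw$ are edges of a common face) is connected, and each edge lies in exactly two faces. Let $\Gamma(P)$ be the automorphism group of the partially ordered set of vertices, edges and faces of $P$, let $G(P)$ be the group of isometries of $\mathbb{E}^3$ mapping $P$ to itself, viewed as a subgroup of $\Gamma(P)$, and let $G^{+}(P)$ be the subgroup of proper isometries in $G(P)$. The polyhedron $P$ is a regular polyhedron of index $2$ if $\Gamma(P)$ is transitive on the flags of $P$ and $|\Gamma(P):G(P)|=2$. Let $P$ be a regular polyhedron of index $2$ whose vertices form exactly two orbits under $G(P)$, namely the vertex set of a Platonic solid $S$ with center $o$ and the vertex set of $S^\diamond$, where either $S^\diamond=\lambda S$ (aligned), or $S$ is a tetrahedron and $S^\diamond=-\lambda S$ (opposed), for some $\lambda>0$; here $\pm\lambda S$ denotes the image of $S$ under the homothety with center $o$ and ratio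 $\pm\lambda$. For a vertex $v$ of $S$ let $v^\diamond$ be its image under this homothety. For vertices $v,w$ of $S$, the length of a segment $\{v,w^\diamond\}$ is the length of a shortest path from $v$ to $w$ along edges of $S$ if $S^\diamond=\lambda S$, and the length of a shortest path from $v$ to the point $-w$ of $-S$ (the point on the ray from $o$ through $w^\diamond$) along the edges of the cube whose vertices are those of $S$ and $-S$ if $S^\diamond=-\lambda S$. We say that $P$ has edge length $\ell$ if every edge of $P$ is of the form $\{v,w^\diamond\}$ with $v,w$ vertices of $S$, and has length $\ell$. Then: 1. $S$ is not a cube. 2. If $S$ is a tetrahedron or an octahedron, then $P$ has edge length $1$. 3. If $S$ is an icosahedron, then $P$ has edge length $1$ or edge length $2$. 4. If $S$ is a dodecahedron, then $P$ has edge length $1$ or edge length $4$. 5. In every case $G^{+}(P)$ is simply edge-transitive: for any two edges $e,e'$ of $P$ there is exactly one element of $G^{+}(P)$ that maps $e$ to $e'$. -/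

import Mathlib

/-- Euclidean 3-space. -/
abbrev E3 : Type := EuclideanSpace ℝ (Fin 3)

/-- A polygon `(v₁, …, vₙ)` with `n ≥ 3` distinct vertices, recorded as the set of its edges. A
segment is recorded as the unordered pair of its endpoints. -/
def IsPolygon (F : Set (Sym2 E3)) : Prop :=
  ∃ n : ℕ, 3 ≤ n ∧ ∃ v : ZMod n → E3, Function.Injective v ∧
    F = Set.range fun i => s(v i, v (i + 1))

/-- The graph on the point set `V` whose edges are the segments in `E`. -/
def segmentGraph (V : Set E3) (E : Set (Sym2 E3)) : SimpleGraph V where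
  Adj u w := u ≠ w ∧ s((u : E3), (w : E3)) ∈ E
  symm.symm _ _ h := ⟨h.1.symm, Sym2.eq_swap ▸ h.2⟩
  loopless.irrefl _ h := h.1 rfl

/-- The vertex-figure at `v`: its vertices are the neighbours of `v`, and `u`, `w` are joined when
`uv` and `vw` are edges of a common face. -/
def vertexFigure (E : Set (Sym2 E3)) (𝓕 : Set (Set (Sym2 E3))) (v : E3) :
    SimpleGraph {u : E3 // s(u, v) ∈ E} where
  Adj u w := u ≠ w ∧ ∃ F ∈ 𝓕, s((u : E3), v) ∈ F ∧ s((w : E3), v) ∈ F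
  symm.symm _ _ h := ⟨h.1.symm, h.2.imp fun _ hF => ⟨hF.1, hF.2.2, hF.2.1⟩⟩
  loopless.irrefl _ h := h.1 rfl

/-- A finite geometric polyhedron in Euclidean 3-space. -/
structure GeometricPolyhedron where
  /-- the vertices -/
  verts : Set E3
  /-- the edges -/
  edges : Set (Sym2 E3)
  /-- the faces -/
  faces : Set (Set (Sym2 E3))
  finite_verts : verts.Finite
  edge_not_diag : ∀ e ∈ edges, ¬ e.IsDiag
  edge_verts : ∀ e ∈ edges, ∀ v ∈ e, v ∈ verts
  face_polygon : ∀ F ∈ faces, IsPolygon F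
  face_edges : ∀ F ∈ faces, F ⊆ edges
  connected : (segmentGraph verts edges).Connected
  vertexFigure_connected : ∀ v ∈ verts, (vertexFigure edges faces v).Connected
  two_faces : ∀ e ∈ edges, {F ∈ faces | e ∈ F}.ncard = 2

namespace GeometricPolyhedron

/-- The proper elements of the underlying abstract polyhedron. -/
inductive Cell (P : GeometricPolyhedron) : Type
  | vertex (v : P.verts) : Cell P
  | edge (e : P.edges) : Cell P
  | face (F : P.faces) : Cell P

variable {P : GeometricPolyhedron}

/-- Incidence of the proper elements. -/
def Cell.Le : P.Cell → P.Cell → Prop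
  | .vertex v, .vertex w => v = w
  | .vertex v, .edge e => (v : E3) ∈ (e : Sym2 E3)
  | .vertex v, .face F => ∃ e ∈ (F : Set (Sym2 E3)), (v : E3) ∈ e
  | .edge e, .edge e' => e = e'
  | .edge e, .face F => (e : Sym2 E3) ∈ (F : Set (Sym2 E3))
  | .face F, .face F' => F = F'
  | _, _ => False

/-- The underlying abstract polyhedron, as the partially ordered set of its proper elements. -/
instance : PartialOrder P.Cell where
  le := Cell.Le
  le_refl c := by cases c <;> simp [Cell.Le]
  le_trans a b c hab hbc := by
    cases a <;> cases b <;> cases c <;> simp_all [Cell.Le]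
    exact ⟨_, hbc, hab⟩
  le_antisymm a b hab hba := by
    cases a <;> cases b <;> simp_all [Cell.Le]

/-- A flag: a vertex, an edge and a face, all mutually incident. -/
structure FlagOf (P : GeometricPolyhedron) where
  v : P.verts
  e : P.edges
  F : P.faces
  vertex_le_edge : Cell.vertex v ≤ Cell.edge e
  edge_le_face : Cell.edge e ≤ Cell.face F

/-- The combinatorial automorphism group `Γ(P)`. -/
abbrev AutGroup (P : GeometricPolyhedron) : Type := P.Cell ≃o P.Cell

/-- Combinatorial regularity: `Γ(P)` is transitive on the flags. -/
def IsCombRegular (P : GeometricPolyhedron) : Prop :=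
  ∀ Φ Ψ : P.FlagOf, ∃ γ : P.AutGroup,
    γ (.vertex Φ.v) = .vertex Ψ.v ∧ γ (.edge Φ.e) = .edge Ψ.e ∧ γ (.face Φ.F) = .face Ψ.F

/-- `g` maps `P` to itself. -/
def Preserves (P : GeometricPolyhedron) (g : E3 ≃ᵃⁱ[ℝ] E3) : Prop :=
  (∀ v, g v ∈ P.verts ↔ v ∈ P.verts) ∧ (∀ e, Sym2.map g e ∈ P.edges ↔ e ∈ P.edges) ∧
    (∀ F, Sym2.map g '' F ∈ P.faces ↔ F ∈ P.faces)

theorem sym2_map_mul (g h : E3 ≃ᵃⁱ[ℝ] E3) (e : Sym2 E3) :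
    Sym2.map (g * h) e = Sym2.map g (Sym2.map h e) := by
  rw [Sym2.map_map]; rfl

theorem sym2_map_one (e : Sym2 E3) : Sym2.map (1 : E3 ≃ᵃⁱ[ℝ] E3) e = e := by
  have : ⇑(1 : E3 ≃ᵃⁱ[ℝ] E3) = id := rfl
  rw [this, Sym2.map_id]; rfl

theorem image_map_mul (g h : E3 ≃ᵃⁱ[ℝ] E3) (F : Set (Sym2 E3)) :
    Sym2.map (g * h) '' F = Sym2.map g '' (Sym2.map h '' F) := by
  rw [Set.image_image]; exact Set.image_congr fun e _ => sym2_map_mul g h e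

theorem image_map_one (F : Set (Sym2 E3)) : Sym2.map (1 : E3 ≃ᵃⁱ[ℝ] E3) '' F = F := by
  rw [Set.image_congr fun e _ => sym2_map_one e, Set.image_id']

/-- The geometric symmetry group `G(P)`. -/
def symmetryGroup (P : GeometricPolyhedron) : Subgroup (E3 ≃ᵃⁱ[ℝ] E3) where
  carrier := {g | P.Preserves g}
  one_mem' := ⟨fun _ => Iff.rfl, fun e => by rw [sym2_map_one], fun F => by rw [image_map_one]⟩
  mul_mem' {g h} hg hh := ⟨fun v => (hg.1 (h v)).trans (hh.1 v),
    fun e => by rw [sym2_map_mul]; exact (hg.2.1 _).trans (hh.2.1 e),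
    fun F => by rw [image_map_mul]; exact (hg.2.2 _).trans (hh.2.2 F)⟩
  inv_mem' {g} hg := by
    refine ⟨fun v => ?_, fun e => ?_, fun F => ?_⟩
    · rw [← hg.1, show g (g⁻¹ v) = v from g.apply_symm_apply v]
    · rw [← hg.2.1, ← sym2_map_mul, mul_inv_cancel, sym2_map_one]
    · rw [← hg.2.2, ← image_map_mul, mul_inv_cancel, image_map_one]

/-- The group `G⁺(P)` of the proper isometries in `G(P)`. -/
def rotationGroup (P : GeometricPolyhedron) : Subgroup (E3 ≃ᵃⁱ[ℝ] E3) where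
  carrier := {g | g ∈ P.symmetryGroup ∧
    LinearMap.det (g.linearIsometryEquiv.toLinearEquiv : E3 →ₗ[ℝ] E3) = 1}
  one_mem' := ⟨one_mem _, LinearMap.det_id⟩
  mul_mem' {g h} hg hh := ⟨mul_mem hg.1 hh.1, by
    have := LinearMap.det_comp (g.linearIsometryEquiv.toLinearEquiv : E3 →ₗ[ℝ] E3)
      (h.linearIsometryEquiv.toLinearEquiv : E3 →ₗ[ℝ] E3)
    rw [hg.2, hh.2, mul_one] at this
    exact this⟩
  inv_mem' {g} hg := ⟨inv_mem hg.1, by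
    have := LinearEquiv.det_symm_mul_det g.linearIsometryEquiv.toLinearEquiv
    rw [hg.2, mul_one] at this
    exact this⟩

/-- A symmetry moves the proper elements of `P`. -/
noncomputable instance : MulAction P.symmetryGroup P.Cell where
  smul g
    | .vertex v => .vertex ⟨g.1 v, (g.2.1 v).2 v.2⟩
    | .edge e => .edge ⟨Sym2.map g.1 e, (g.2.2.1 e).2 e.2⟩
    | .face F => .face ⟨Sym2.map g.1 '' F, (g.2.2.2 F).2 F.2⟩
  one_smul c := by
    rcases c with v | e | F
    · rfl
    · exact congrArg Cell.edge (Subtype.ext (sym2_map_one _))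
    · exact congrArg Cell.face (Subtype.ext (image_map_one _))
  mul_smul g h c := by
    rcases c with v | e | F
    · rfl
    · exact congrArg Cell.edge (Subtype.ext (sym2_map_mul _ _ _))
    · exact congrArg Cell.face (Subtype.ext (image_map_mul _ _ _))

theorem Cell.smul_le_smul (g : P.symmetryGroup) {c d : P.Cell} (h : c ≤ d) : g • c ≤ g • d := by
  rcases c with v | e | F <;> rcases d with w | e' | F' <;> try exact h.elim
  · cases (show v = w from h); exact le_rfl
  · exact Sym2.mem_map.2 ⟨_, h, rfl⟩
  · obtain ⟨e, he, hv⟩ := (show ∃ e ∈ (F' : Set (Sym2 E3)), (v : E3) ∈ e from h)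
    exact ⟨_, Set.mem_image_of_mem _ he, Sym2.mem_map.2 ⟨_, hv, rfl⟩⟩
  · cases (show e = e' from h); exact le_rfl
  · exact Set.mem_image_of_mem _ h
  · cases (show F = F' from h); exact le_rfl

/-- The homomorphism `G(P) → Γ(P)` through which symmetries are viewed as automorphisms. -/
noncomputable def toAut (P : GeometricPolyhedron) : P.symmetryGroup →* P.AutGroup where
  toFun g :=
    { MulAction.toPerm g with
      map_rel_iff' := fun {c d} => ⟨fun h => by
        have := Cell.smul_le_smul g⁻¹ h
        simpa using this, fun h => Cell.smul_le_smul g h⟩ }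
  map_one' := RelIso.ext fun c => one_smul P.symmetryGroup c
  map_mul' g h := RelIso.ext fun c => mul_smul g h c

/-- A regular polyhedron of index 2: combinatorially regular, with `|Γ(P) : G(P)| = 2`. -/
def IsRegularOfIndexTwo (P : GeometricPolyhedron) : Prop :=
  P.IsCombRegular ∧ P.toAut.range.index = 2

/-- `O` is an orbit of `G(P)` on the vertices of `P`. -/
def IsVertexOrbit (P : GeometricPolyhedron) (O : Set E3) : Prop :=
  ∃ v ∈ P.verts, O = {w | ∃ g ∈ P.symmetryGroup, g v = w}

/-- `G⁺(P)` is simply transitive on the edges of `P`. -/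
def RotationsSimplyEdgeTransitive (P : GeometricPolyhedron) : Prop :=
  ∀ e ∈ P.edges, ∀ e' ∈ P.edges, ∃! g : E3 ≃ᵃⁱ[ℝ] E3, g ∈ P.rotationGroup ∧ Sym2.map g e = e'

end GeometricPolyhedron

/-- The five kinds of Platonic solids. -/
inductive PlatonicKind : Type
  | tetrahedron
  | cube
  | octahedron
  | icosahedron
  | dodecahedron

/-- The vertices of a standard model of each Platonic solid, with center `0`. -/
noncomputable def PlatonicKind.modelVerts : PlatonicKind → Set E3
  | .tetrahedron => {x | (∀ i, |x i| = 1) ∧ x 0 * x 1 * x 2 = 1}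
  | .cube => {x | ∀ i, |x i| = 1}
  | .octahedron => {x | ∃ i, |x i| = 1 ∧ x (i + 1) = 0 ∧ x (i + 2) = 0}
  | .icosahedron => {x | ∃ i, x i = 0 ∧ |x (i + 1)| = 1 ∧ |x (i + 2)| = Real.goldenRatio}
  | .dodecahedron => {x | (∀ i, |x i| = 1) ∨
      ∃ i, x i = 0 ∧ |x (i + 1)| = Real.goldenRatio⁻¹ ∧ |x (i + 2)| = Real.goldenRatio}

/-- A Platonic solid in Euclidean 3-space: the image of a standard model under a similarity
`x ↦ center + scale • iso x`. -/
structure PlatonicSolid where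
  kind : PlatonicKind
  center : E3
  scale : ℝ
  scale_pos : 0 < scale
  iso : E3 ≃ₗᵢ[ℝ] E3

/-- The graph on a point set whose edges join the pairs of distinct points at minimal distance.
For the vertex set of a Platonic solid this is the edge graph of the solid. -/
def minDistGraph (V : Set E3) : SimpleGraph E3 where
  Adj a b := a ∈ V ∧ b ∈ V ∧ a ≠ b ∧ ∀ c ∈ V, ∀ d ∈ V, c ≠ d → dist a b ≤ dist c d
  symm.symm a b h := ⟨h.2.1, h.1, h.2.2.1.symm, dist_comm a b ▸ h.2.2.2⟩
  loopless.irrefl _ h := h.2.2.1 rfl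

namespace PlatonicSolid

/-- The vertices of a Platonic solid. -/
noncomputable def verts (S : PlatonicSolid) : Set E3 :=
  (fun x => S.center + S.scale • S.iso x) '' S.kind.modelVerts

/-- The homothety `v ↦ v^◇` with the center of `S` and ratio `μ`. It takes `S` to a solid `S^◇`
aligned with `S` when `0 < μ`, and to one aligned with `-S` when `μ < 0`. -/
noncomputable def diamond (S : PlatonicSolid) (μ : ℝ) : E3 → E3 :=
  AffineMap.homothety S.center μ

/-- The combinatorial length of the segment from the vertex `v` of `S` to the vertex `w^◇` of
`S^◇`: if the two solids are aligned, the length of a shortest path from `v` to `w` along edges of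
`S`; if they are opposed tetrahedra, the length of a shortest path from `v` to the point `-w` (on the
ray of `w^◇`) along the edges of the cube whose vertices are those of `S` and `-S`. -/
noncomputable def combLength (S : PlatonicSolid) (μ : ℝ) (v w : E3) : ℕ :=
  if 0 < μ then (minDistGraph S.verts).dist v w
  else (minDistGraph (S.verts ∪ S.diamond (-1) '' S.verts)).dist v (S.diamond (-1) w)

end PlatonicSolid

/-- Every edge of `P` joins a vertex of `S` with a vertex of `S^◇` and has combinatorial length
`l`; that is, the edge length of `P` is `l`. -/
def GeometricPolyhedron.HasEdgeLength (P : GeometricPolyhedron) (S : PlatonicSolid) (μ : ℝ)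
    (l : ℕ) : Prop :=
  ∀ e ∈ P.edges, ∃ v ∈ S.verts, ∃ w ∈ S.verts, e = s(v, S.diamond μ w) ∧ S.combLength μ v w = l

/-!
Since there are two vertex orbits, `Γ(P)` contains an element that takes a given vertex `v` out of
its orbit under `G(P)`; as `G(P)` has index 2, the stabilizer of `v` in `Γ(P)` therefore lies in
`G(P)`. So the symmetries that fix `v` permute the flags at `v` transitively. This has three
consequences. Every edge joins the two orbits, and `G(P)` is transitive on the edges, so the
directions from the center to the end points of an edge have the same inner product for all edges.
These directions are linearly independent, because otherwise all the edges at a vertex would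
coincide. Finally, exchanging the two faces at an edge is a nontrivial symmetry that fixes the edge
pointwise, hence the reflection in the plane spanned by the edge and the center: this turns edge
transitivity of `G(P)` into simple edge transitivity of `G⁺(P)`.

In a Platonic solid the inner product of two vertices determines their combinatorial distance, and
only a few inner products belong to linearly independent directions. For the cube they would all
disconnect `P`, and for the dodecahedron those of combinatorial length 2 and 3 are excluded because
the solid is not symmetric under the reflection above. These are finite facts about vectors over
`ℤ[φ]`.
-/

open Matrix

theorem stabilizer_le_of_index_eq_two {Γ X : Type*} [Group Γ] [MulAction Γ X] {H : Subgroup Γ}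
    (hH : H.index = 2) {x : X} {δ : Γ} (hδ : ∀ h ∈ H, h • x ≠ δ • x) :
    MulAction.stabilizer Γ x ≤ H := by
  intro γ hγ
  by_contra hγH
  have hδγ : δ * γ ∈ H :=
    (Subgroup.mul_mem_iff_of_index_two hH).2 (iff_of_false (fun h => hδ δ h rfl) hγH)
  exact hδ _ hδγ (by rw [mul_smul, MulAction.mem_stabilizer_iff.1 hγ])

theorem IsPolygon.exists_ne_neighbors {F : Set (Sym2 E3)} (hF : IsPolygon F) {e : Sym2 E3}
    (he : e ∈ F) {v : E3} (hv : v ∈ e) : ∃ a b, a ≠ b ∧ s(v, a) ∈ F ∧ s(v, b) ∈ F := by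
  obtain ⟨n, hn, w, hw, rfl⟩ := hF
  obtain ⟨j, rfl⟩ : ∃ j, w j = v := by
    obtain ⟨i, rfl⟩ := he
    rcases Sym2.mem_iff.1 hv with rfl | rfl
    exacts [⟨i, rfl⟩, ⟨i + 1, rfl⟩]
  have : Fact (2 < n) := ⟨hn⟩
  refine ⟨w (j + 1), w (j - 1), fun h => ?_, ⟨j, rfl⟩, j - 1, ?_⟩
  · exact ZMod.neg_one_ne_one (by linear_combination -hw h)
  · simp [Sym2.eq_swap]

namespace GeometricPolyhedron

variable {P : GeometricPolyhedron}

theorem exists_edge_of_mem_verts {v : E3} (hv : v ∈ P.verts) : ∃ e ∈ P.edges, v ∈ e := by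
  obtain ⟨u, hu⟩ := (P.vertexFigure_connected v hv).nonempty
  exact ⟨_, hu, Sym2.mem_mk_right u v⟩

theorem exists_two_faces {e : Sym2 E3} (he : e ∈ P.edges) :
    ∃ F ∈ P.faces, ∃ F' ∈ P.faces, e ∈ F ∧ e ∈ F' ∧ F ≠ F' := by
  obtain ⟨F, F', hne, h⟩ := Set.ncard_eq_two.1 (P.two_faces e he)
  have hF : F ∈ {F ∈ P.faces | e ∈ F} := h ▸ Set.mem_insert F {F'}
  have hF' : F' ∈ {F ∈ P.faces | e ∈ F} := h ▸ Set.mem_insert_of_mem F rfl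
  exact ⟨F, hF.1, F', hF'.1, hF.2, hF'.2, hne⟩

theorem exists_flag {v : E3} (hv : v ∈ P.verts) : ∃ Φ : P.FlagOf, (Φ.v : E3) = v := by
  obtain ⟨e, he, hve⟩ := exists_edge_of_mem_verts hv
  obtain ⟨F, hF, -, -, heF, -⟩ := exists_two_faces he
  exact ⟨⟨⟨v, hv⟩, ⟨e, he⟩, ⟨F, hF⟩, hve, heF⟩, rfl⟩

theorem exists_other_neighbor {a b : E3} (he : s(a, b) ∈ P.edges) :
    ∃ c ≠ b, s(a, c) ∈ P.edges := by
  obtain ⟨F, hF, -, -, heF, -⟩ := exists_two_faces he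
  obtain ⟨c, d, hcd, hc, hd⟩ :=
    (P.face_polygon F hF).exists_ne_neighbors heF (Sym2.mem_mk_left a b)
  by_cases hcb : c = b
  · exact ⟨d, hcb ▸ hcd.symm, P.face_edges F hF hd⟩
  · exact ⟨c, hcb, P.face_edges F hF hc⟩

theorem verts_subset_of_closed {A : Set E3} (hA : ∀ a b, s(a, b) ∈ P.edges → a ∈ A → b ∈ A)
    {a : E3} (ha : a ∈ P.verts) (haA : a ∈ A) : P.verts ⊆ A := by
  intro b hb
  have hwalk : ∀ (x y : P.verts) (_ : (segmentGraph P.verts P.edges).Walk x y),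
      (x : E3) ∈ A → (y : E3) ∈ A := by
    intro x y p
    induction p with
    | nil => exact id
    | cons h _ ih => exact fun hx => ih (hA _ _ h.2 hx)
  obtain ⟨p⟩ := P.connected.preconnected ⟨a, ha⟩ ⟨b, hb⟩
  exact hwalk _ _ p haA

theorem map_mem_edges {g : E3 ≃ᵃⁱ[ℝ] E3} (hg : g ∈ P.symmetryGroup) {a b : E3}
    (he : s(a, b) ∈ P.edges) : s(g a, g b) ∈ P.edges :=
  (hg.2.1 s(a, b)).2 he

namespace IsVertexOrbit

variable {O O' : Set E3} {v : E3}

theorem eq_orbit (hO : P.IsVertexOrbit O) (hv : v ∈ O) :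
    O = {w | ∃ g ∈ P.symmetryGroup, g v = w} := by
  obtain ⟨u, -, rfl⟩ := hO
  obtain ⟨g, hg, rfl⟩ := hv
  ext w
  constructor
  · rintro ⟨h, hh, rfl⟩
    exact ⟨h * g⁻¹, mul_mem hh (inv_mem hg), congrArg h (g.symm_apply_apply u)⟩
  · rintro ⟨h, hh, rfl⟩
    exact ⟨h * g, mul_mem hh hg, rfl⟩

theorem nonempty (hO : P.IsVertexOrbit O) : O.Nonempty := by
  obtain ⟨v, -, rfl⟩ := hO
  exact ⟨v, 1, one_mem _, rfl⟩

theorem map_mem (hO : P.IsVertexOrbit O) {g : E3 ≃ᵃⁱ[ℝ] E3} (hg : g ∈ P.symmetryGroup)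
    (hv : v ∈ O) : g v ∈ O := by
  rw [hO.eq_orbit hv]
  exact ⟨g, hg, rfl⟩

theorem exists_map_eq (hO : P.IsVertexOrbit O) (hv : v ∈ O) {w : E3} (hw : w ∈ O) :
    ∃ g ∈ P.symmetryGroup, g v = w := by
  rwa [hO.eq_orbit hv] at hw

theorem image_eq (hO : P.IsVertexOrbit O) {g : E3 ≃ᵃⁱ[ℝ] E3} (hg : g ∈ P.symmetryGroup) :
    g '' O = O := by
  refine (Set.image_subset_iff.2 fun v hv => hO.map_mem hg hv).antisymm fun v hv => ?_
  exact ⟨g⁻¹ v, hO.map_mem (inv_mem hg) hv, g.apply_symm_apply v⟩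

theorem disjoint (hO : P.IsVertexOrbit O) (hO' : P.IsVertexOrbit O') (hne : O ≠ O') :
    Disjoint O O' :=
  Set.disjoint_left.2 fun _ hv hv' => hne ((hO.eq_orbit hv).trans (hO'.eq_orbit hv').symm)

end IsVertexOrbit

theorem mem_range_toAut_of_fixes_vertex (hP : P.IsRegularOfIndexTwo) {v u : P.verts}
    (hvu : ∀ g ∈ P.symmetryGroup, g (v : E3) ≠ u) {γ : P.AutGroup}
    (hγ : γ (.vertex v) = .vertex v) : γ ∈ P.toAut.range := by
  obtain ⟨Φ, hΦ⟩ := exists_flag v.2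
  obtain ⟨Ψ, hΨ⟩ := exists_flag u.2
  obtain ⟨δ, hδ, -⟩ := hP.1 Φ Ψ
  rw [Subtype.ext hΦ, Subtype.ext hΨ] at hδ
  refine stabilizer_le_of_index_eq_two (X := P.Cell) hP.2 (x := .vertex v) (δ := δ) ?_ hγ
  rintro _ ⟨g, rfl⟩ h
  exact hvu g.1 g.2 (congrArg Subtype.val (Cell.vertex.inj (h.trans hδ)))

/-- `P` is a regular polyhedron of index 2 whose vertices form exactly the two orbits `O`, `O'`
under its symmetry group. -/
structure HasTwoOrbits (P : GeometricPolyhedron) (O O' : Set E3) : Prop where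
  regular : P.IsRegularOfIndexTwo
  left : P.IsVertexOrbit O
  right : P.IsVertexOrbit O'
  ne : O ≠ O'
  verts_eq : P.verts = O ∪ O'

namespace HasTwoOrbits

variable {O O' : Set E3} {a b : E3}

protected theorem symm (h : P.HasTwoOrbits O O') : P.HasTwoOrbits O' O :=
  ⟨h.regular, h.right, h.left, h.ne.symm, h.verts_eq.trans (Set.union_comm O O')⟩

theorem left_subset (h : P.HasTwoOrbits O O') : O ⊆ P.verts :=
  h.verts_eq ▸ Set.subset_union_left

theorem disjoint (h : P.HasTwoOrbits O O') : Disjoint O O' :=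
  h.left.disjoint h.right h.ne

theorem exists_map_ne_of_mem_verts (h : P.HasTwoOrbits O O') {v : E3} (hv : v ∈ P.verts) :
    ∃ u ∈ P.verts, ∀ g ∈ P.symmetryGroup, g v ≠ u := by
  wlog hvO : v ∈ O generalizing O O'
  · exact this h.symm ((h.verts_eq ▸ hv).resolve_left hvO)
  obtain ⟨u, hu⟩ := h.right.nonempty
  exact ⟨u, h.symm.left_subset hu,
    fun g hg hgv => h.disjoint.notMem_of_mem_left (h.left.map_mem hg hvO) (hgv ▸ hu)⟩

theorem exists_symmetry_map_flag (h : P.HasTwoOrbits O O') {v : E3} {e e' : Sym2 E3}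
    {F F' : Set (Sym2 E3)} (he : e ∈ P.edges) (he' : e' ∈ P.edges) (hF : F ∈ P.faces)
    (hF' : F' ∈ P.faces) (hve : v ∈ e) (hve' : v ∈ e') (heF : e ∈ F) (heF' : e' ∈ F') :
    ∃ g ∈ P.symmetryGroup, g v = v ∧ Sym2.map g e = e' ∧ Sym2.map g '' F = F' := by
  have hv := P.edge_verts e he v hve
  obtain ⟨u, hu, huv⟩ := h.exists_map_ne_of_mem_verts hv
  obtain ⟨γ, hγv, hγe, hγF⟩ := h.regular.1 ⟨⟨v, hv⟩, ⟨e, he⟩, ⟨F, hF⟩, hve, heF⟩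
    ⟨⟨v, hv⟩, ⟨e', he'⟩, ⟨F', hF'⟩, hve', heF'⟩
  obtain ⟨g, rfl⟩ :=
    mem_range_toAut_of_fixes_vertex h.regular (v := ⟨v, hv⟩) (u := ⟨u, hu⟩) huv hγv
  exact ⟨g.1, g.2, congrArg Subtype.val (Cell.vertex.inj hγv),
    congrArg Subtype.val (Cell.edge.inj hγe), congrArg Subtype.val (Cell.face.inj hγF)⟩

theorem exists_symmetry_map_neighbor (h : P.HasTwoOrbits O O') {b' : E3} (he : s(a, b) ∈ P.edges)
    (he' : s(a, b') ∈ P.edges) : ∃ g ∈ P.symmetryGroup, g a = a ∧ g b = b' := by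
  obtain ⟨F, hF, -, -, heF, -⟩ := exists_two_faces he
  obtain ⟨F', hF', -, -, heF', -⟩ := exists_two_faces he'
  obtain ⟨g, hg, ha, hge, -⟩ := h.exists_symmetry_map_flag he he' hF hF' (Sym2.mem_mk_left a b)
    (Sym2.mem_mk_left a b') heF heF'
  rw [Sym2.map_mk, ha] at hge
  exact ⟨g, hg, ha, Sym2.congr_right.1 hge⟩

theorem exists_map_ne (h : P.HasTwoOrbits O O') (he : s(a, b) ∈ P.edges) :
    ∃ g ∈ P.symmetryGroup, g a = a ∧ g b ≠ b := by
  obtain ⟨c, hc, hec⟩ := exists_other_neighbor he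
  obtain ⟨g, hg, ha, hb⟩ := h.exists_symmetry_map_neighbor he hec
  exact ⟨g, hg, ha, hb ▸ hc⟩

theorem exists_ne_one_fixes_edge (h : P.HasTwoOrbits O O') (he : s(a, b) ∈ P.edges) :
    ∃ g ∈ P.symmetryGroup, g a = a ∧ g b = b ∧ g ≠ 1 := by
  obtain ⟨F, hF, F', hF', heF, heF', hne⟩ := exists_two_faces he
  obtain ⟨g, hg, ha, hge, hgF⟩ := h.exists_symmetry_map_flag he he hF hF'
    (Sym2.mem_mk_left a b) (Sym2.mem_mk_left a b) heF heF'
  rw [Sym2.map_mk, ha] at hge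
  refine ⟨g, hg, ha, Sym2.congr_right.1 hge, ?_⟩
  rintro rfl
  exact hne ((image_map_one F).symm.trans hgF)

theorem exists_symmetry_map_edge (h : P.HasTwoOrbits O O') {a' b' : E3} (he : s(a, b) ∈ P.edges)
    (he' : s(a', b') ∈ P.edges) (ha : a ∈ O) (ha' : a' ∈ O) :
    ∃ g ∈ P.symmetryGroup, g a = a' ∧ g b = b' := by
  obtain ⟨g, hg, rfl⟩ := h.left.exists_map_eq ha ha'
  obtain ⟨k, hk, hka, hkb⟩ := h.exists_symmetry_map_neighbor (map_mem_edges hg he) he'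
  exact ⟨k * g, mul_mem hk hg, hka, hkb⟩

theorem mem_right_of_edge (h : P.HasTwoOrbits O O') (he : s(a, b) ∈ P.edges) (ha : a ∈ O) :
    b ∈ O' := by
  have hb : b ∈ P.verts := P.edge_verts _ he b (Sym2.mem_mk_right a b)
  refine (h.verts_eq ▸ hb).resolve_left fun hbO => ?_
  have hclosed : ∀ x y, s(x, y) ∈ P.edges → x ∈ O → y ∈ O := by
    intro x y hxy hx
    obtain ⟨g, hg, -, rfl⟩ := h.exists_symmetry_map_edge he hxy ha hx
    exact h.left.map_mem hg hbO
  obtain ⟨u, hu⟩ := h.right.nonempty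
  exact h.disjoint.notMem_of_mem_right hu
    (verts_subset_of_closed hclosed (h.left_subset ha) ha (h.symm.left_subset hu))

theorem exists_eq_mk_of_mem_edges (h : P.HasTwoOrbits O O') {e : Sym2 E3} (he : e ∈ P.edges) :
    ∃ a ∈ O, ∃ b ∈ O', e = s(a, b) := by
  induction e with
  | h a b =>
    rcases h.verts_eq ▸ P.edge_verts _ he a (Sym2.mem_mk_left a b) with ha | ha
    · exact ⟨a, ha, b, h.mem_right_of_edge he ha, rfl⟩
    · exact ⟨b, h.symm.mem_right_of_edge he ha, a, ha, Sym2.eq_swap⟩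

theorem map_eq_of_map_edge_eq (h : P.HasTwoOrbits O O') {a' b' : E3} (ha : a ∈ O) (hb' : b' ∈ O')
    {g : E3 ≃ᵃⁱ[ℝ] E3} (hg : g ∈ P.symmetryGroup) (hge : Sym2.map g s(a, b) = s(a', b')) :
    g a = a' ∧ g b = b' := by
  rw [Sym2.map_mk, Sym2.eq_iff] at hge
  refine hge.resolve_right fun hswap => ?_
  exact h.disjoint.notMem_of_mem_left (h.left.map_mem hg ha) (hswap.1 ▸ hb')

end HasTwoOrbits

end GeometricPolyhedron

theorem linearIndependent_pair_of_norm_eq {E : Type*} [NormedAddCommGroup E] [NormedSpace ℝ E]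
    {x y : E} (hnorm : ‖x‖ = ‖y‖) (hne : x ≠ y) (hneg : x ≠ -y) :
    LinearIndependent ℝ ![x, y] := by
  have hx : x ≠ 0 := by
    rintro rfl
    exact hne (norm_eq_zero.1 (hnorm.symm.trans norm_zero)).symm
  refine (LinearIndependent.pair_iff' hx).2 fun a ha => ?_
  have habs : |a| = 1 := by
    rw [← ha, norm_smul, Real.norm_eq_abs] at hnorm
    exact (mul_eq_right₀ (norm_ne_zero_iff.2 hx)).1 hnorm.symm
  obtain rfl | rfl := eq_or_eq_neg_of_abs_eq habs
  · exact hne (by simpa using ha)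
  · exact hneg (by simp [← ha])

section Isometry

variable {E : Type*} [NormedAddCommGroup E] [InnerProductSpace ℝ E]

theorem eq_one_or_eq_reflection_of_fixes {W : Submodule ℝ E} [W.HasOrthogonalProjection]
    (hW : Module.finrank ℝ Wᗮ = 1) {M : E ≃ₗᵢ[ℝ] E} (hM : ∀ w ∈ W, M w = w) :
    M = 1 ∨ M = W.reflection := by
  have hMperp : ∀ n ∈ Wᗮ, M n ∈ Wᗮ := fun n hn w hw => by
    rw [← hM w hw, M.inner_map_map]
    exact hn w hw
  obtain ⟨n, hn, hspan⟩ := finrank_eq_one_iff'.1 hW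
  obtain ⟨c, hc⟩ := hspan ⟨M n, hMperp n n.2⟩
  have hMn : c • (n : E) = M n := congrArg Subtype.val hc
  have habs : |c| = 1 := by
    have hnorm : ‖c • (n : E)‖ = ‖(n : E)‖ := by rw [hMn, M.norm_map]
    rw [norm_smul, Real.norm_eq_abs] at hnorm
    exact (mul_eq_right₀ (norm_ne_zero_iff.2 (Subtype.coe_ne_coe.2 hn))).1 hnorm
  have hMperp_apply : ∀ m ∈ Wᗮ, M m = c • m := by
    intro m hm
    obtain ⟨d, hd⟩ := hspan ⟨m, hm⟩
    obtain rfl : d • (n : E) = m := congrArg Subtype.val hd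
    rw [map_smul, ← hMn, smul_comm]
  have hM_apply : ∀ u, M u = W.starProjection u + c • Wᗮ.starProjection u := by
    intro u
    conv_lhs => rw [← W.starProjection_add_starProjection_orthogonal u, map_add,
      hM _ (W.starProjection_apply_mem u), hMperp_apply _ (Wᗮ.starProjection_apply_mem u)]
  obtain rfl | rfl := eq_or_eq_neg_of_abs_eq habs
  · left
    ext u
    rw [hM_apply, one_smul, W.starProjection_add_starProjection_orthogonal]
    rfl
  · right
    ext u
    rw [hM_apply, Submodule.reflection_apply, Submodule.starProjection_orthogonal_val]
    module

theorem det_linearIsometryEquiv_eq_one_or_eq_neg_one [FiniteDimensional ℝ E] (M : E ≃ₗᵢ[ℝ] E) :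
    LinearMap.det (M.toLinearEquiv : E →ₗ[ℝ] E) = 1 ∨
      LinearMap.det (M.toLinearEquiv : E →ₗ[ℝ] E) = -1 := by
  refine eq_or_eq_neg_of_abs_eq ?_
  rw [← LinearMap.normDet_eq_abs_det]
  exact M.toLinearIsometry.normDet_eq_one

end Isometry

theorem map_centroid_of_image_eq {k V P ι : Type*} [DivisionRing k] [CharZero k] [AddCommGroup V]
    [Module k V] [AddTorsor V P] {s : Finset ι} (hs : s.Nonempty) {p : ι → P}
    (hp : Function.Injective p) {g : P ≃ᵃ[k] P} (hg : g '' (p '' s) = p '' s) :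
    g (s.centroid k p) = s.centroid k p := by
  calc g (s.centroid k p) = s.centroid k (g ∘ p) :=
        s.map_affineCombination p _ (s.sum_centroidWeights_eq_one_of_nonempty k hs) g.toAffineMap
    _ = s.centroid k p :=
        s.centroid_eq_of_inj_on_of_image_eq k s (fun _ _ _ _ h => hp (g.injective h))
          (fun _ _ _ _ h => hp h) ((Set.image_comp g p s).trans hg)

section Descent

variable {V ι : Type*} {G : SimpleGraph V} {p : ι → V} {t : ι} {f : ι → ℕ}

theorem le_length_of_le_add_one (hp : Function.Injective p)
    (hclosed : ∀ x v, G.Adj (p x) v → v ∈ Set.range p) (hzero : f t = 0)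
    (hle : ∀ x y, G.Adj (p x) (p y) → f x ≤ f y + 1) {u v : V} (q : G.Walk u v) (hv : v = p t)
    {x : ι} (hu : u = p x) : f x ≤ q.length := by
  induction q generalizing x with
  | nil => simp [hp (hu.symm.trans hv), hzero]
  | cons hadj q ih =>
    subst hu
    obtain ⟨y, rfl⟩ := hclosed x _ hadj
    exact (hle x y hadj).trans (Nat.add_le_add_right (ih hv rfl) 1)

theorem exists_walk_length_eq_of_descent (hzero : f t = 0)
    (hdescent : ∀ x ≠ t, ∃ y, G.Adj (p x) (p y) ∧ f x = f y + 1) {n : ℕ} {x : ι} (hx : f x = n) :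
    ∃ q : G.Walk (p x) (p t), q.length = n := by
  induction n generalizing x with
  | zero =>
    obtain rfl : x = t := by
      by_contra hne
      obtain ⟨y, -, hy⟩ := hdescent x hne
      omega
    exact ⟨.nil, rfl⟩
  | succ n ih =>
    obtain ⟨y, hadj, hy⟩ := hdescent x (by rintro rfl; omega)
    obtain ⟨q, hq⟩ := ih (by omega : f y = n)
    exact ⟨.cons hadj q, by rw [SimpleGraph.Walk.length_cons, hq]⟩

theorem dist_eq_of_descent (hp : Function.Injective p)
    (hclosed : ∀ x v, G.Adj (p x) v → v ∈ Set.range p)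
    (hzero : f t = 0) (hle : ∀ x y, G.Adj (p x) (p y) → f x ≤ f y + 1)
    (hdescent : ∀ x ≠ t, ∃ y, G.Adj (p x) (p y) ∧ f x = f y + 1) (x : ι) :
    G.dist (p x) (p t) = f x := by
  obtain ⟨q, hq⟩ := exists_walk_length_eq_of_descent hzero hdescent rfl
  refine (hq ▸ SimpleGraph.dist_le q).antisymm ?_
  obtain ⟨q', hq'⟩ := q.reachable.exists_walk_length_eq_dist
  exact hq' ▸ le_length_of_le_add_one hp hclosed hzero hle q' rfl rfl

end Descent

/-! ### Standard models over `ℤ[φ]` -/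


/-- The ring `ℤ[φ]`, where `φ` is the golden ratio; `⟨a, b⟩` stands for `a + b φ`. The coordinates
of the standard models lie in it, so that finite statements about them can be decided. -/
abbrev GoldenInt : Type := QuadraticAlgebra ℤ 1 1

namespace GoldenInt

/-- The embedding `ℤ[φ] → ℝ`. -/
noncomputable def toReal : GoldenInt →ₐ[ℤ] ℝ :=
  QuadraticAlgebra.lift ⟨Real.goldenRatio, by linear_combination Real.goldenRatio_sq⟩

/-- The golden ratio. -/
def phi : GoldenInt := ⟨0, 1⟩

/-- The inverse of the golden ratio. -/
def phiInv : GoldenInt := ⟨-1, 1⟩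

theorem toReal_apply (z : GoldenInt) : toReal z = z.re + z.im * Real.goldenRatio := by
  simp [toReal, QuadraticAlgebra.lift]

@[simp]
theorem toReal_phi : toReal phi = Real.goldenRatio := by
  simp [toReal_apply, phi]

@[simp]
theorem toReal_phiInv : toReal phiInv = Real.goldenRatio⁻¹ := by
  rw [toReal_apply, Real.inv_goldenRatio, ← Real.one_sub_goldenRatio]
  simp only [phiInv]
  push_cast
  ring

theorem toReal_injective : Function.Injective toReal := by
  refine (injective_iff_map_eq_zero toReal).2 fun z hz => ?_
  rw [toReal_apply] at hz
  have him : z.im = 0 := by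
    by_contra hne
    exact ((Real.goldenRatio_irrational.intCast_mul hne).intCast_add z.re).ne_zero hz
  ext
  · simpa [him] using hz
  · exact him

theorem toReal_nonneg_of_nonneg_im {z : GoldenInt} (h : 0 ≤ 2 * z.re + 3 * z.im)
    (him : 0 ≤ z.im) : 0 ≤ toReal z := by
  have hφ : (3 / 2 : ℝ) ≤ Real.goldenRatio := by
    nlinarith [Real.goldenRatio_sq, Real.goldenRatio_pos]
  calc (0 : ℝ) ≤ z.re + z.im * (3 / 2) := by
        have : (0 : ℝ) ≤ 2 * z.re + 3 * z.im := by exact_mod_cast h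
        linarith
    _ ≤ z.re + z.im * Real.goldenRatio :=
        add_le_add_right (mul_le_mul_of_nonneg_left hφ (by exact_mod_cast him)) _
    _ = toReal z := (toReal_apply z).symm

theorem abs_toReal_eq_toReal_iff {z w : GoldenInt} (hw : 0 ≤ toReal w) :
    |toReal z| = toReal w ↔ z ^ 2 = w ^ 2 := by
  rw [← toReal_injective.eq_iff, map_pow, map_pow, sq_eq_sq_iff_abs_eq_abs, abs_of_nonneg hw]

theorem abs_toReal_eq_one_iff {z : GoldenInt} : |toReal z| = 1 ↔ z ^ 2 = 1 := by
  simpa using abs_toReal_eq_toReal_iff (z := z) (w := 1) (by simp)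

theorem abs_toReal_eq_goldenRatio_iff {z : GoldenInt} :
    |toReal z| = Real.goldenRatio ↔ z ^ 2 = phi ^ 2 := by
  simpa using abs_toReal_eq_toReal_iff (z := z) (w := phi) (by simp [Real.goldenRatio_pos.le])

theorem abs_toReal_eq_inv_goldenRatio_iff {z : GoldenInt} :
    |toReal z| = Real.goldenRatio⁻¹ ↔ z ^ 2 = phiInv ^ 2 := by
  simpa using abs_toReal_eq_toReal_iff (z := z) (w := phiInv) (by
    rw [toReal_phiInv]
    positivity)

end GoldenInt

open GoldenInt

/-- Vectors with coordinates in `ℤ[φ]`. -/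
abbrev GoldenVec : Type := Fin 3 → GoldenInt

namespace GoldenVec

/-- The embedding of `ℤ[φ]³` into Euclidean space. -/
noncomputable def toE3 : GoldenVec →+ E3 where
  toFun x := WithLp.toLp 2 fun i => toReal (x i)
  map_zero' := by ext; simp
  map_add' x y := by ext; simp

@[simp]
theorem toE3_apply (x : GoldenVec) (i : Fin 3) : toE3 x i = toReal (x i) := rfl

theorem inner_toE3 (x y : GoldenVec) : inner ℝ (toE3 x) (toE3 y) = toReal (x ⬝ᵥ y) := by
  simp [PiLp.inner_apply, dotProduct, mul_comm]

theorem toE3_injective : Function.Injective toE3 := fun _ _ h =>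
  funext fun i => toReal_injective (congrArg (fun u : E3 => u i) h)

end GoldenVec

open GoldenVec

namespace PlatonicKind

/-- The equations of `modelVerts`, with `|t| = c` replaced by `t² = c²`, over `ℤ[φ]`. -/
def IsModelVert : PlatonicKind → GoldenVec → Prop
  | .tetrahedron, x => (∀ i, x i ^ 2 = 1) ∧ x 0 * x 1 * x 2 = 1
  | .cube, x => ∀ i, x i ^ 2 = 1
  | .octahedron, x => ∃ i, x i ^ 2 = 1 ∧ x (i + 1) = 0 ∧ x (i + 2) = 0
  | .icosahedron, x => ∃ i, x i = 0 ∧ x (i + 1) ^ 2 = 1 ∧ x (i + 2) ^ 2 = phi ^ 2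
  | .dodecahedron, x => (∀ i, x i ^ 2 = 1) ∨
      ∃ i, x i = 0 ∧ x (i + 1) ^ 2 = phiInv ^ 2 ∧ x (i + 2) ^ 2 = phi ^ 2

instance (k : PlatonicKind) (x : GoldenVec) : Decidable (k.IsModelVert x) := by
  cases k <;> unfold IsModelVert <;> infer_instance

/-- Finitely many numbers that include all coordinates of vertices of the standard model. -/
def coords : PlatonicKind → Finset GoldenInt
  | .tetrahedron | .cube => {1, -1}
  | .octahedron => {0, 1, -1}
  | .icosahedron => {0, 1, -1, phi, -phi}
  | .dodecahedron => {0, 1, -1, phi, -phi, phiInv, -phiInv}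

/-- The vertices of the standard model over `ℤ[φ]`. -/
def vecs (k : PlatonicKind) : Finset GoldenVec :=
  {x ∈ Fintype.piFinset fun _ => k.coords | k.IsModelVert x}

theorem toE3_mem_modelVerts_iff {k : PlatonicKind} {x : GoldenVec} :
    toE3 x ∈ k.modelVerts ↔ k.IsModelVert x := by
  cases k <;>
    simp only [modelVerts, IsModelVert, Set.mem_ofPred_eq, toE3_apply, abs_toReal_eq_one_iff,
      abs_toReal_eq_goldenRatio_iff, abs_toReal_eq_inv_goldenRatio_iff,
      map_eq_zero_iff toReal toReal_injective, ← map_mul, map_eq_one_iff toReal toReal_injective]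

theorem exists_abs_coord_of_mem_modelVerts {k : PlatonicKind} {u : E3} (hu : u ∈ k.modelVerts)
    (i : Fin 3) : ∃ z ∈ k.coords, |u i| = toReal z := by
  have hcyclic : ∀ i j : Fin 3, i = j ∨ i = j + 1 ∨ i = j + 2 := by decide
  have hsign : ∀ j, |u j| = 1 → ∃ z ∈ k.coords, |u j| = toReal z := fun j hj =>
    ⟨1, by cases k <;> decide, by rw [hj, map_one]⟩
  cases k
  case tetrahedron => exact hsign i (hu.1 i)
  case cube => exact hsign i (hu i)
  case octahedron =>
    obtain ⟨j, hj⟩ := hu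
    obtain rfl | rfl | rfl := hcyclic i j <;> simp [coords, hj]
  case icosahedron =>
    obtain ⟨j, hj⟩ := hu
    obtain rfl | rfl | rfl := hcyclic i j <;> simp [coords, hj]
  case dodecahedron =>
    obtain hu | ⟨j, hj⟩ := hu
    · exact hsign i (hu i)
    · obtain rfl | rfl | rfl := hcyclic i j <;> simp [coords, hj]

theorem exists_coord_of_mem_modelVerts {k : PlatonicKind} {u : E3} (hu : u ∈ k.modelVerts)
    (i : Fin 3) : ∃ z ∈ k.coords, toReal z = u i := by
  obtain ⟨z, hz, hzu⟩ := exists_abs_coord_of_mem_modelVerts hu i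
  have hneg : ∀ z ∈ k.coords, -z ∈ k.coords := by cases k <;> decide
  rcases eq_or_eq_neg_of_abs_eq hzu with h | h
  · exact ⟨z, hz, h.symm⟩
  · exact ⟨-z, hneg z hz, by rw [map_neg, h]⟩

theorem modelVerts_eq_image (k : PlatonicKind) :
    k.modelVerts = toE3 '' (k.vecs : Set GoldenVec) := by
  ext u
  constructor
  · intro hu
    choose x hx hxu using exists_coord_of_mem_modelVerts hu
    obtain rfl : toE3 x = u := by ext i; exact hxu i
    exact ⟨x, by simpa [vecs, hx] using toE3_mem_modelVerts_iff.1 hu, rfl⟩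
  · rintro ⟨x, hx, rfl⟩
    exact toE3_mem_modelVerts_iff.2 (Finset.mem_filter.1 hx).2

/-- The inner products of two vertices of the standard model, in decreasing order. The one with
index `d` is attained by the vertices at distance `d` in the edge graph. -/
def grams : PlatonicKind → List GoldenInt
  | .tetrahedron => [3, -1]
  | .cube => [3, 1, -1, -3]
  | .octahedron => [1, 0, -1]
  | .icosahedron => [⟨2, 1⟩, ⟨0, 1⟩, ⟨0, -1⟩, ⟨-2, -1⟩]
  | .dodecahedron => [3, ⟨-1, 2⟩, 1, -1, ⟨1, -2⟩, -3]

/-- The distance in the edge graph of two vertices of the standard model, as a function of their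
inner product. -/
def level (k : PlatonicKind) (z : GoldenInt) : ℕ := k.grams.idxOf z

/-- The squared circumradius of the standard model. -/
def sqRadius (k : PlatonicKind) : GoldenInt := k.grams.getD 0 0

/-- The inner product of adjacent vertices of the standard model. -/
def adjGram (k : PlatonicKind) : GoldenInt := k.grams.getD 1 0

theorem dotProduct_self_of_mem_vecs (k : PlatonicKind) : ∀ x ∈ k.vecs, x ⬝ᵥ x = k.sqRadius := by
  cases k <;> decide +kernel

theorem level_dotProduct_eq_zero_iff (k : PlatonicKind) :
    ∀ x ∈ k.vecs, ∀ y ∈ k.vecs, k.level (x ⬝ᵥ y) = 0 ↔ x = y := by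
  cases k <;> decide +kernel

theorem toReal_dotProduct_le_adjGram (k : PlatonicKind) {x y : GoldenVec} (hx : x ∈ k.vecs)
    (hy : y ∈ k.vecs) (hxy : x ≠ y) : toReal (x ⬝ᵥ y) ≤ toReal k.adjGram := by
  have hnonneg : ∀ x ∈ k.vecs, ∀ y ∈ k.vecs, x ≠ y →
      0 ≤ 2 * (k.adjGram - x ⬝ᵥ y).re + 3 * (k.adjGram - x ⬝ᵥ y).im ∧
        0 ≤ (k.adjGram - x ⬝ᵥ y).im := by
    cases k <;> decide +kernel
  rw [← sub_nonneg, ← map_sub]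
  exact toReal_nonneg_of_nonneg_im (hnonneg x hx y hy hxy).1 (hnonneg x hx y hy hxy).2

theorem exists_dotProduct_eq_adjGram (k : PlatonicKind) :
    ∃ x ∈ k.vecs, ∃ y ∈ k.vecs, x ≠ y ∧ x ⬝ᵥ y = k.adjGram := by
  cases k <;> decide +kernel

theorem level_le_level_add_one (k : PlatonicKind) :
    ∀ x ∈ k.vecs, ∀ y ∈ k.vecs, x ⬝ᵥ y = k.adjGram → ∀ z ∈ k.vecs,
      k.level (x ⬝ᵥ z) ≤ k.level (y ⬝ᵥ z) + 1 := by
  cases k <;> decide +kernel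

theorem exists_level_eq_level_add_one (k : PlatonicKind) :
    ∀ x ∈ k.vecs, ∀ z ∈ k.vecs, x ≠ z → ∃ y ∈ k.vecs,
      x ⬝ᵥ y = k.adjGram ∧ k.level (x ⬝ᵥ z) = k.level (y ⬝ᵥ z) + 1 := by
  cases k <;> decide +kernel

theorem sum_vecs (k : PlatonicKind) : ∑ x ∈ k.vecs, x = 0 := by
  cases k <;> decide +kernel

theorem dodecahedron_exists_determined_off_plane :
    ∀ x ∈ vecs .dodecahedron, ∀ y ∈ vecs .dodecahedron, x ⬝ᵥ y = 1 ∨ x ⬝ᵥ y = -1 →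
      ∃ u ∈ vecs .dodecahedron, u ⬝ᵥ (x ⨯₃ y) ≠ 0 ∧ ∀ u' ∈ vecs .dodecahedron,
        u' ⬝ᵥ x = u ⬝ᵥ x → u' ⬝ᵥ y = u ⬝ᵥ y → u' = u := by
  decide +kernel

theorem level_dotProduct_of_ne (k : PlatonicKind) :
    ∀ x ∈ k.vecs, ∀ y ∈ k.vecs, x ≠ y → x ≠ -y →
      (k = .tetrahedron ∨ k = .octahedron → k.level (x ⬝ᵥ y) = 1) ∧
      (k = .icosahedron → k.level (x ⬝ᵥ y) = 1 ∨ k.level (x ⬝ᵥ y) = 2) ∧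
      (k = .dodecahedron → ¬(x ⬝ᵥ y = 1 ∨ x ⬝ᵥ y = -1) →
        k.level (x ⬝ᵥ y) = 1 ∨ k.level (x ⬝ᵥ y) = 4) := by
  cases k <;> simp only [reduceCtorEq, or_false, or_true, false_imp_iff, and_true,
    true_and, implies_true, forall_const] <;> decide +kernel

theorem sqRadius_ne_adjGram (k : PlatonicKind) : k.sqRadius ≠ k.adjGram := by
  cases k <;> decide +kernel

theorem mem_vecs_cube_iff {x : GoldenVec} :
    x ∈ vecs .cube ↔ x ∈ vecs .tetrahedron ∨ -x ∈ vecs .tetrahedron := by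
  have hcube : ∀ x ∈ vecs .cube, x ∈ vecs .tetrahedron ∨ -x ∈ vecs .tetrahedron := by
    decide +kernel
  have htetrahedron : ∀ x ∈ vecs .tetrahedron, x ∈ vecs .cube ∧ -x ∈ vecs .cube := by
    decide +kernel
  refine ⟨hcube x, ?_⟩
  rintro (h | h)
  · exact (htetrahedron x h).1
  · exact neg_neg x ▸ (htetrahedron (-x) h).2

theorem level_cube_dotProduct_neg : ∀ x ∈ vecs .tetrahedron, ∀ y ∈ vecs .tetrahedron, x ≠ y →
    level .cube (x ⬝ᵥ -y) = level .tetrahedron (x ⬝ᵥ y) := by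
  decide +kernel

theorem cube_prod_coord_eq : ∀ x ∈ vecs .cube, ∀ y ∈ vecs .cube, x ≠ y → x ≠ -y →
    x 0 * x 1 * x 2 = -(x ⬝ᵥ y) * (y 0 * y 1 * y 2) := by
  decide +kernel

end PlatonicKind

/-! ### Platonic solids in space -/

namespace PlatonicSolid

variable (S : PlatonicSolid) {r r' : ℝ} {x y x' y' : GoldenVec}

/-- The vector of the standard model `x`, in the position of the solid `S`. -/
noncomputable def direction : GoldenVec →+ E3 :=
  (S.iso.toLinearEquiv : E3 →+ E3).comp toE3

/-- The point that corresponds to the vector `x` of the standard model in the solid `r S`, the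
image of `S` under the homothety about its center with ratio `r`. -/
noncomputable def point (r : ℝ) (x : GoldenVec) : E3 :=
  S.center + (r * S.scale) • S.direction x

theorem inner_direction (x y : GoldenVec) :
    inner ℝ (S.direction x) (S.direction y) = toReal (x ⬝ᵥ y) :=
  (S.iso.inner_map_map _ _).trans (inner_toE3 x y)

theorem direction_injective : Function.Injective S.direction :=
  S.iso.injective.comp toE3_injective

theorem norm_direction_of_mem_vecs (hx : x ∈ S.kind.vecs) :
    ‖S.direction x‖ = √(toReal S.kind.sqRadius) := by
  rw [norm_eq_sqrt_real_inner, inner_direction, S.kind.dotProduct_self_of_mem_vecs x hx]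

theorem point_injective (hr : r ≠ 0) : Function.Injective (S.point r) :=
  (add_right_injective S.center).comp
    ((smul_right_injective E3 (mul_ne_zero hr S.scale_pos.ne')).comp S.direction_injective)

theorem point_neg (r : ℝ) (x : GoldenVec) : S.point r (-x) = S.point (-r) x := by
  rw [point, point, map_neg, smul_neg, neg_mul, neg_smul]

theorem verts_eq : S.verts = S.point 1 '' S.kind.vecs := by
  rw [verts, PlatonicKind.modelVerts_eq_image, Set.image_image]
  exact Set.image_congr fun x _ => by rw [point, one_mul]; rfl

theorem diamond_point (μ r : ℝ) (x : GoldenVec) :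
    S.diamond μ (S.point r x) = S.point (μ * r) x := by
  rw [diamond, AffineMap.homothety_apply, point, point, vsub_eq_sub, add_sub_cancel_left,
    vadd_eq_add, smul_smul, mul_assoc, add_comm]

theorem image_diamond_verts (μ : ℝ) : S.diamond μ '' S.verts = S.point μ '' S.kind.vecs := by
  simp only [verts_eq, Set.image_image, diamond_point, mul_one]

section EdgeGraph

theorem dist_point_le_iff (hx : x ∈ S.kind.vecs) (hy : y ∈ S.kind.vecs) (hx' : x' ∈ S.kind.vecs)
    (hy' : y' ∈ S.kind.vecs) :
    dist (S.point 1 x) (S.point 1 y) ≤ dist (S.point 1 x') (S.point 1 y') ↔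
      toReal (x' ⬝ᵥ y') ≤ toReal (x ⬝ᵥ y) := by
  have hdist : ∀ {x y}, x ∈ S.kind.vecs → y ∈ S.kind.vecs →
      dist (S.point 1 x) (S.point 1 y) ^ 2 =
        S.scale ^ 2 * (2 * (toReal S.kind.sqRadius - toReal (x ⬝ᵥ y))) := by
    intro x y hx hy
    rw [point, point, dist_add_left, dist_smul₀, one_mul, Real.norm_of_nonneg S.scale_pos.le,
      mul_pow, dist_eq_norm, norm_sub_sq_real, ← real_inner_self_eq_norm_sq,
      ← real_inner_self_eq_norm_sq, inner_direction, inner_direction, inner_direction,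
      S.kind.dotProduct_self_of_mem_vecs x hx, S.kind.dotProduct_self_of_mem_vecs y hy]
    ring
  rw [← sq_le_sq₀ dist_nonneg dist_nonneg, hdist hx hy, hdist hx' hy',
    mul_le_mul_iff_right₀ (pow_pos S.scale_pos 2), mul_le_mul_iff_right₀ two_pos,
    sub_le_sub_iff_left]

theorem adj_point_iff (hx : x ∈ S.kind.vecs) (hy : y ∈ S.kind.vecs) :
    (minDistGraph S.verts).Adj (S.point 1 x) (S.point 1 y) ↔ x ⬝ᵥ y = S.kind.adjGram := by
  have hmem : ∀ {z}, z ∈ S.kind.vecs → S.point 1 z ∈ S.verts := fun hz =>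
    S.verts_eq ▸ Set.mem_image_of_mem _ hz
  have hinj := S.point_injective one_ne_zero
  constructor
  · rintro ⟨-, -, hne, hmin⟩
    obtain ⟨z, hz, w, hw, hzw, hadj⟩ := S.kind.exists_dotProduct_eq_adjGram
    have hle := hmin _ (hmem hz) _ (hmem hw) (hinj.ne hzw)
    rw [S.dist_point_le_iff hx hy hz hw, hadj] at hle
    exact toReal_injective
      ((S.kind.toReal_dotProduct_le_adjGram hx hy (ne_of_apply_ne _ hne)).antisymm hle)
  · intro hadj
    have hxy : x ≠ y := by
      rintro rfl
      exact S.kind.sqRadius_ne_adjGram ((S.kind.dotProduct_self_of_mem_vecs x hx).symm.trans hadj)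
    refine ⟨hmem hx, hmem hy, hinj.ne hxy, ?_⟩
    rw [verts_eq]
    rintro _ ⟨z, hz, rfl⟩ _ ⟨w, hw, rfl⟩ hzw
    rw [S.dist_point_le_iff hx hy hz hw, hadj]
    exact S.kind.toReal_dotProduct_le_adjGram hz hw (ne_of_apply_ne _ hzw)

theorem dist_minDistGraph (hx : x ∈ S.kind.vecs) (hy : y ∈ S.kind.vecs) :
    (minDistGraph S.verts).dist (S.point 1 x) (S.point 1 y) = S.kind.level (x ⬝ᵥ y) := by
  refine dist_eq_of_descent (p := fun z : S.kind.vecs => S.point 1 z) (t := ⟨y, hy⟩)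
    (f := fun z => S.kind.level (z ⬝ᵥ y)) ((S.point_injective one_ne_zero).comp
      Subtype.val_injective) ?_ ((S.kind.level_dotProduct_eq_zero_iff y hy y hy).2 rfl) ?_ ?_
    ⟨x, hx⟩
  · intro z v hadj
    obtain ⟨w, hw, rfl⟩ := S.verts_eq ▸ hadj.2.1
    exact ⟨⟨w, hw⟩, rfl⟩
  · intro z w hadj
    exact S.kind.level_le_level_add_one z z.2 w w.2 ((S.adj_point_iff z.2 w.2).1 hadj) y hy
  · intro z hz
    obtain ⟨w, hw, hadj, hlevel⟩ :=
      S.kind.exists_level_eq_level_add_one z z.2 y hy fun h => hz (Subtype.ext h)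
    exact ⟨⟨w, hw⟩, (S.adj_point_iff z.2 hw).2 hadj, hlevel⟩

/-- If `S` is a tetrahedron, the cube whose vertices are those of `S` and `-S`. -/
def circumscribedCube : PlatonicSolid := { S with kind := .cube }

theorem verts_circumscribedCube (hS : S.kind = .tetrahedron) :
    S.circumscribedCube.verts = S.verts ∪ S.diamond (-1) '' S.verts := by
  have hpoint : S.circumscribedCube.point = S.point := rfl
  rw [image_diamond_verts, verts_eq, verts_eq, hpoint, hS]
  ext v
  constructor
  · rintro ⟨x, hx, rfl⟩
    refine (PlatonicKind.mem_vecs_cube_iff.1 hx).imp (fun h => ⟨x, h, rfl⟩) fun h => ⟨-x, h, ?_⟩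
    rw [point_neg, neg_neg]
  · rintro (⟨x, hx, rfl⟩ | ⟨x, hx, rfl⟩)
    · exact ⟨x, PlatonicKind.mem_vecs_cube_iff.2 (.inl hx), rfl⟩
    · exact ⟨-x, PlatonicKind.mem_vecs_cube_iff.2 (.inr (by rwa [neg_neg])), S.point_neg 1 x⟩

theorem combLength_eq_level {μ : ℝ} (hμ : μ ≠ 0) (hopp : μ < 0 → S.kind = .tetrahedron)
    (hx : x ∈ S.kind.vecs) (hy : y ∈ S.kind.vecs) (hxy : x ≠ y) :
    S.combLength μ (S.point 1 x) (S.point 1 y) = S.kind.level (x ⬝ᵥ y) := by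
  rcases hμ.lt_or_gt with hneg | hpos
  · have hS := hopp hneg
    have hcube : x ∈ S.circumscribedCube.kind.vecs ∧ -y ∈ S.circumscribedCube.kind.vecs :=
      ⟨PlatonicKind.mem_vecs_cube_iff.2 (.inl (hS ▸ hx)),
        PlatonicKind.mem_vecs_cube_iff.2 (.inr (by rwa [neg_neg, ← hS]))⟩
    rw [combLength, if_neg hneg.not_gt, ← S.verts_circumscribedCube hS, diamond_point, mul_one,
      ← point_neg, hS, ← PlatonicKind.level_cube_dotProduct_neg x (hS ▸ hx) y (hS ▸ hy) hxy]
    exact S.circumscribedCube.dist_minDistGraph hcube.1 hcube.2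
  · rw [combLength, if_pos hpos, S.dist_minDistGraph hx hy]

end EdgeGraph

section Isometries

theorem vecs_nonempty : S.kind.vecs.Nonempty := by
  obtain ⟨x, hx, -⟩ := S.kind.exists_dotProduct_eq_adjGram
  exact ⟨x, hx⟩

theorem centroid_point (r : ℝ) : S.kind.vecs.centroid ℝ (S.point r) = S.center := by
  have hsum : ∑ x ∈ S.kind.vecs, (S.point r x - S.center) = 0 := by
    simp only [point, add_sub_cancel_left]
    rw [← Finset.smul_sum, ← map_sum, S.kind.sum_vecs, map_zero, smul_zero]
  rw [Finset.centroid_def, Finset.affineCombination_eq_weightedVSubOfPoint_vadd_of_sum_eq_one _ _ _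
    (Finset.sum_centroidWeights_eq_one_of_nonempty ℝ _ S.vecs_nonempty) S.center,
    Finset.weightedVSubOfPoint_apply]
  simp only [Finset.centroidWeights_apply, vsub_eq_sub]
  rw [← Finset.smul_sum, hsum, smul_zero, zero_vadd]

variable {S} {g : E3 ≃ᵃⁱ[ℝ] E3}

theorem map_center_of_image_eq (hr : r ≠ 0)
    (hg : g '' (S.point r '' S.kind.vecs) = S.point r '' S.kind.vecs) : g S.center = S.center := by
  rw [← S.centroid_point r]
  exact map_centroid_of_image_eq S.vecs_nonempty (S.point_injective hr) (g := g.toAffineEquiv) hg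

theorem map_point_eq_iff (hg : g S.center = S.center) (hr : r ≠ 0) :
    g (S.point r x) = S.point r x' ↔ g.linearIsometryEquiv (S.direction x) = S.direction x' := by
  have hmap : g (S.point r x) =
      S.center + (r * S.scale) • g.linearIsometryEquiv (S.direction x) := by
    have h := g.map_vadd S.center ((r * S.scale) • S.direction x)
    rwa [vadd_eq_add, vadd_eq_add, hg, map_smul, add_comm, add_comm _ S.center] at h
  rw [hmap, point, add_right_inj, smul_right_inj (mul_ne_zero hr S.scale_pos.ne')]

theorem dotProduct_eq_of_map_point (hg : g S.center = S.center) (hr : r ≠ 0) (hr' : r' ≠ 0)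
    (hx : g (S.point r x) = S.point r x') (hy : g (S.point r' y) = S.point r' y') :
    x ⬝ᵥ y = x' ⬝ᵥ y' := by
  rw [map_point_eq_iff hg hr] at hx
  rw [map_point_eq_iff hg hr'] at hy
  apply toReal_injective
  rw [← S.inner_direction, ← S.inner_direction, ← hx, ← hy, LinearIsometryEquiv.inner_map_map]

theorem linearIndependent_direction (hx : x ∈ S.kind.vecs) (hy : y ∈ S.kind.vecs) (hxy : x ≠ y)
    (hxy' : x ≠ -y) : LinearIndependent ℝ ![S.direction x, S.direction y] := by
  refine linearIndependent_pair_of_norm_eq ?_ (S.direction_injective.ne hxy) ?_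
  · rw [S.norm_direction_of_mem_vecs hx, S.norm_direction_of_mem_vecs hy]
  · rw [← map_neg]
    exact S.direction_injective.ne hxy'

end Isometries

end PlatonicSolid

/-! ### Polyhedra with the vertices of two Platonic solids -/

namespace GeometricPolyhedron.HasTwoOrbits

theorem eq_of_forall_edge {P : GeometricPolyhedron} {ι ι' α : Type*} {s : Set ι} {s' : Set ι'}
    {p : ι → E3} {p' : ι' → E3} (h : P.HasTwoOrbits (p '' s) (p' '' s'))
    (hp : Function.Injective p) {f : ι → α} {f' : ι' → α}
    (hff' : ∀ x ∈ s, ∀ y ∈ s', s(p x, p' y) ∈ P.edges → f x = f' y) {x₀ x₁ : ι} (hx₀ : x₀ ∈ s)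
    (hx₁ : x₁ ∈ s) : f x₀ = f x₁ := by
  have hclosed : ∀ a b, s(a, b) ∈ P.edges →
      a ∈ p '' {x ∈ s | f x₀ = f x} ∪ p' '' {y ∈ s' | f x₀ = f' y} →
      b ∈ p '' {x ∈ s | f x₀ = f x} ∪ p' '' {y ∈ s' | f x₀ = f' y} := by
    rintro _ b he (⟨x, ⟨hx, hfx⟩, rfl⟩ | ⟨y, ⟨hy, hfy⟩, rfl⟩)
    · obtain ⟨y, hy, rfl⟩ := h.mem_right_of_edge he ⟨x, hx, rfl⟩
      exact .inr ⟨y, ⟨hy, hfx.trans (hff' x hx y hy he)⟩, rfl⟩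
    · obtain ⟨x, hx, rfl⟩ := h.symm.mem_right_of_edge he ⟨y, hy, rfl⟩
      exact .inl ⟨x, ⟨hx, hfy.trans (hff' x hx y hy (Sym2.eq_swap ▸ he)).symm⟩, rfl⟩
  have hsub := verts_subset_of_closed hclosed (h.left_subset ⟨x₀, hx₀, rfl⟩)
    (.inl ⟨x₀, ⟨hx₀, rfl⟩, rfl⟩)
  rcases hsub (h.left_subset ⟨x₁, hx₁, rfl⟩) with ⟨x, ⟨-, hfx⟩, hx⟩ | ⟨y, ⟨hy, -⟩, hyx⟩
  · exact hfx.trans (congrArg f (hp hx))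
  · exact (h.disjoint.notMem_of_mem_left ⟨x₁, hx₁, rfl⟩ ⟨y, hy, hyx⟩).elim

section Platonic

variable {P : GeometricPolyhedron} {S : PlatonicSolid} {r r' : ℝ} {x y : GoldenVec}
  (h : P.HasTwoOrbits (S.point r '' S.kind.vecs) (S.point r' '' S.kind.vecs))

include h

theorem exists_eq_mk_point {e : Sym2 E3} (he : e ∈ P.edges) :
    ∃ x ∈ S.kind.vecs, ∃ y ∈ S.kind.vecs, e = s(S.point r x, S.point r' y) := by
  obtain ⟨_, ⟨x, hx, rfl⟩, _, ⟨y, hy, rfl⟩, rfl⟩ := h.exists_eq_mk_of_mem_edges he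
  exact ⟨x, hx, y, hy, rfl⟩

theorem exists_edge :
    ∃ x ∈ S.kind.vecs, ∃ y ∈ S.kind.vecs, s(S.point r x, S.point r' y) ∈ P.edges := by
  obtain ⟨v, hv⟩ := h.left.nonempty
  obtain ⟨e, he, -⟩ := exists_edge_of_mem_verts (h.left_subset hv)
  obtain ⟨x, hx, y, hy, rfl⟩ := h.exists_eq_mk_point he
  exact ⟨x, hx, y, hy, he⟩

theorem map_center (hr : r ≠ 0) {g : E3 ≃ᵃⁱ[ℝ] E3} (hg : g ∈ P.symmetryGroup) :
    g S.center = S.center :=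
  PlatonicSolid.map_center_of_image_eq hr (h.left.image_eq hg)

variable (hr : r ≠ 0) (hr' : r' ≠ 0)

include hr hr'

theorem dotProduct_eq_of_edges {x' y' : GoldenVec} (hx : x ∈ S.kind.vecs) (hx' : x' ∈ S.kind.vecs)
    (he : s(S.point r x, S.point r' y) ∈ P.edges)
    (he' : s(S.point r x', S.point r' y') ∈ P.edges) : x ⬝ᵥ y = x' ⬝ᵥ y' := by
  obtain ⟨g, hg, hgx, hgy⟩ := h.exists_symmetry_map_edge he he' ⟨x, hx, rfl⟩ ⟨x', hx', rfl⟩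
  exact PlatonicSolid.dotProduct_eq_of_map_point (h.map_center hr hg) hr hr' hgx hgy

theorem ne_and_ne_neg_of_edge (he : s(S.point r x, S.point r' y) ∈ P.edges) :
    x ≠ y ∧ x ≠ -y := by
  rw [← not_or]
  intro hxy
  obtain ⟨g, hg, hgx, hgy⟩ := h.exists_map_ne he
  have hc := h.map_center hr hg
  rw [PlatonicSolid.map_point_eq_iff hc hr] at hgx
  refine hgy ((PlatonicSolid.map_point_eq_iff hc hr').2 ?_)
  rcases hxy with rfl | rfl
  · exact hgx
  · rwa [map_neg, map_neg, neg_inj] at hgx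

theorem finrank_orthogonal_span_edge (hx : x ∈ S.kind.vecs) (hy : y ∈ S.kind.vecs)
    (he : s(S.point r x, S.point r' y) ∈ P.edges) :
    Module.finrank ℝ (Submodule.span ℝ (Set.range ![S.direction x, S.direction y]))ᗮ = 1 := by
  obtain ⟨hne, hneg⟩ := h.ne_and_ne_neg_of_edge hr hr' he
  refine Submodule.finrank_add_finrank_orthogonal' ?_
  rw [finrank_span_eq_card (PlatonicSolid.linearIndependent_direction hx hy hne hneg)]
  simp

theorem eq_one_or_eq_reflection_of_fixes_edge (hx : x ∈ S.kind.vecs) (hy : y ∈ S.kind.vecs)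
    (he : s(S.point r x, S.point r' y) ∈ P.edges) {g : E3 ≃ᵃⁱ[ℝ] E3} (hg : g ∈ P.symmetryGroup)
    (hgx : g (S.point r x) = S.point r x) (hgy : g (S.point r' y) = S.point r' y) :
    g = 1 ∨ g.linearIsometryEquiv =
      (Submodule.span ℝ (Set.range ![S.direction x, S.direction y])).reflection := by
  have hc := h.map_center hr hg
  have hfix : ∀ w ∈ Submodule.span ℝ (Set.range ![S.direction x, S.direction y]),
      g.linearIsometryEquiv w = w :=
    LinearMap.eqOn_span (f := (g.linearIsometryEquiv.toLinearEquiv : E3 →ₗ[ℝ] E3))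
      (g := LinearMap.id) (Set.forall_mem_range.2 (Fin.forall_fin_two.2
        ⟨(PlatonicSolid.map_point_eq_iff hc hr).1 hgx,
          (PlatonicSolid.map_point_eq_iff hc hr').1 hgy⟩))
  refine (eq_one_or_eq_reflection_of_fixes (h.finrank_orthogonal_span_edge hr hr' hx hy he)
    hfix).imp_left fun hone => ?_
  ext1 v
  have hv := g.map_vadd S.center (v - S.center)
  rw [hone, hc] at hv
  simpa using hv

theorem det_reflection_edge (hx : x ∈ S.kind.vecs) (hy : y ∈ S.kind.vecs)
    (he : s(S.point r x, S.point r' y) ∈ P.edges) {g : E3 ≃ᵃⁱ[ℝ] E3}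
    (hg : g.linearIsometryEquiv =
      (Submodule.span ℝ (Set.range ![S.direction x, S.direction y])).reflection) :
    LinearMap.det (g.linearIsometryEquiv.toLinearEquiv : E3 →ₗ[ℝ] E3) = -1 := by
  rw [hg]
  refine (Submodule.det_reflection _).trans ?_
  rw [h.finrank_orthogonal_span_edge hr hr' hx hy he, pow_one]

theorem exists_reflection_fixes_edge (hx : x ∈ S.kind.vecs) (hy : y ∈ S.kind.vecs)
    (he : s(S.point r x, S.point r' y) ∈ P.edges) :
    ∃ g ∈ P.symmetryGroup, g (S.point r x) = S.point r x ∧ g (S.point r' y) = S.point r' y ∧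
      g.linearIsometryEquiv =
        (Submodule.span ℝ (Set.range ![S.direction x, S.direction y])).reflection := by
  obtain ⟨g, hg, hgx, hgy, hne⟩ := h.exists_ne_one_fixes_edge he
  exact ⟨g, hg, hgx, hgy,
    (h.eq_one_or_eq_reflection_of_fixes_edge hr hr' hx hy he hg hgx hgy).resolve_left hne⟩

theorem exists_rotation_map_edge {e e' : Sym2 E3} (he : e ∈ P.edges) (he' : e' ∈ P.edges) :
    ∃ g ∈ P.rotationGroup, Sym2.map g e = e' := by
  obtain ⟨x, hx, y, hy, rfl⟩ := h.exists_eq_mk_point he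
  obtain ⟨x', hx', y', -, rfl⟩ := h.exists_eq_mk_point he'
  obtain ⟨g, hg, hgx, hgy⟩ := h.exists_symmetry_map_edge he he' ⟨x, hx, rfl⟩ ⟨x', hx', rfl⟩
  rcases det_linearIsometryEquiv_eq_one_or_eq_neg_one g.linearIsometryEquiv with hdet | hdet
  · exact ⟨g, ⟨hg, hdet⟩, by rw [Sym2.map_mk, hgx, hgy]⟩
  · obtain ⟨k, hk, hkx, hky, hrefl⟩ := h.exists_reflection_fixes_edge hr hr' hx hy he
    refine ⟨g * k, ⟨mul_mem hg hk, ?_⟩, ?_⟩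
    · refine (LinearMap.det_comp (g.linearIsometryEquiv.toLinearEquiv : E3 →ₗ[ℝ] E3)
        (k.linearIsometryEquiv.toLinearEquiv : E3 →ₗ[ℝ] E3)).trans ?_
      rw [hdet, h.det_reflection_edge hr hr' hx hy he hrefl, neg_one_mul, neg_neg]
    · rw [sym2_map_mul, Sym2.map_mk, hkx, hky, Sym2.map_mk, hgx, hgy]

theorem eq_one_of_mem_rotationGroup_of_map_edge_eq {e : Sym2 E3} (he : e ∈ P.edges)
    {g : E3 ≃ᵃⁱ[ℝ] E3} (hg : g ∈ P.rotationGroup) (hge : Sym2.map g e = e) : g = 1 := by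
  obtain ⟨x, hx, y, hy, rfl⟩ := h.exists_eq_mk_point he
  obtain ⟨hgx, hgy⟩ := h.map_eq_of_map_edge_eq ⟨x, hx, rfl⟩ ⟨y, hy, rfl⟩ hg.1 hge
  refine (h.eq_one_or_eq_reflection_of_fixes_edge hr hr' hx hy he hg.1 hgx hgy).resolve_right
    fun hrefl => ?_
  have hdet := h.det_reflection_edge hr hr' hx hy he hrefl
  rw [hg.2] at hdet
  norm_num at hdet

theorem rotationsSimplyEdgeTransitive : P.RotationsSimplyEdgeTransitive := by
  intro e he e' he'
  obtain ⟨g, hg, hge⟩ := h.exists_rotation_map_edge hr hr' he he'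
  refine ⟨g, ⟨hg, hge⟩, fun g' ⟨hg', hge'⟩ => ?_⟩
  refine (inv_mul_eq_one.1 (h.eq_one_of_mem_rotationGroup_of_map_edge_eq hr hr' he
    (mul_mem (inv_mem hg) hg') ?_)).symm
  rw [sym2_map_mul, hge', ← hge, ← sym2_map_mul, inv_mul_cancel, sym2_map_one]

theorem dotProduct_ne_of_kind_eq_dodecahedron (hk : S.kind = .dodecahedron) (hx : x ∈ S.kind.vecs)
    (hy : y ∈ S.kind.vecs) (he : s(S.point r x, S.point r' y) ∈ P.edges) :
    ¬(x ⬝ᵥ y = 1 ∨ x ⬝ᵥ y = -1) := by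
  intro hxy
  obtain ⟨u, hu, hcross, hdetermined⟩ :=
    PlatonicKind.dodecahedron_exists_determined_off_plane x (hk ▸ hx) y (hk ▸ hy) hxy
  rw [← hk] at hu hdetermined
  obtain ⟨g, hg, hgx, hgy, hrefl⟩ := h.exists_reflection_fixes_edge hr hr' hx hy he
  have hc := h.map_center hr hg
  -- The reflection in the plane of `x` and `y` takes `u` to a vertex with the same inner products
  -- with `x` and `y`, hence to `u`, although `u` is not in this plane.
  obtain ⟨u', hu', hgu⟩ := h.left.map_mem hg ⟨u, hu, rfl⟩
  obtain rfl : u' = u := hdetermined u' hu'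
    (PlatonicSolid.dotProduct_eq_of_map_point hc hr hr hgu.symm hgx).symm
    (PlatonicSolid.dotProduct_eq_of_map_point hc hr hr' hgu.symm hgy).symm
  have hplane := (PlatonicSolid.map_point_eq_iff hc hr).1 hgu.symm
  rw [hrefl, Submodule.reflection_eq_self_iff] at hplane
  have hnormal : Submodule.span ℝ (Set.range ![S.direction x, S.direction y]) ≤
      (ℝ ∙ S.direction (x ⨯₃ y))ᗮ := by
    simp only [Submodule.span_le, Set.range_subset_iff, Fin.forall_fin_two, SetLike.mem_coe,
      Submodule.mem_orthogonal_singleton_iff_inner_left]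
    exact ⟨(S.inner_direction _ _).trans (by rw [dot_self_cross, map_zero]),
      (S.inner_direction _ _).trans (by rw [dot_cross_self, map_zero])⟩
  have hinner := Submodule.mem_orthogonal_singleton_iff_inner_left.1 (hnormal hplane)
  rw [S.inner_direction] at hinner
  exact hcross ((map_eq_zero_iff toReal toReal_injective).1 hinner)

theorem kind_ne_cube : S.kind ≠ .cube := by
  intro hk
  obtain ⟨x, hx, y, -, he⟩ := h.exists_edge
  -- The vertices of a cube split into two tetrahedra, according to the sign of the product of the
  -- coordinates, and the edges at the vertices of one of them all lead to the same tetrahedron.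
  have hedge : ∀ z ∈ S.kind.vecs, ∀ w ∈ S.kind.vecs, s(S.point r z, S.point r' w) ∈ P.edges →
      z 0 * z 1 * z 2 = -(x ⬝ᵥ y) * (w 0 * w 1 * w 2) := by
    intro z hz w hw hzw
    obtain ⟨hne, hneg⟩ := h.ne_and_ne_neg_of_edge hr hr' hzw
    rw [h.dotProduct_eq_of_edges hr hr' hx hz he hzw]
    exact PlatonicKind.cube_prod_coord_eq z (hk ▸ hz) w (hk ▸ hw) hne hneg
  have hconst := h.eq_of_forall_edge (S.point_injective hr)
    (f := fun z => z 0 * z 1 * z 2) (f' := fun w => -(x ⬝ᵥ y) * (w 0 * w 1 * w 2)) hedge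
    (x₀ := 1) (x₁ := -1) (by rw [hk]; decide +kernel) (by rw [hk]; decide +kernel)
  exact absurd hconst (by decide +kernel)

end Platonic

theorem hasEdgeLength_level {P : GeometricPolyhedron} {S : PlatonicSolid} {μ : ℝ}
    (h : P.HasTwoOrbits (S.point 1 '' S.kind.vecs) (S.point μ '' S.kind.vecs)) (hμ : μ ≠ 0)
    (hopp : μ < 0 → S.kind = .tetrahedron) {x y : GoldenVec} (hx : x ∈ S.kind.vecs)
    (he : s(S.point 1 x, S.point μ y) ∈ P.edges) :
    P.HasEdgeLength S μ (S.kind.level (x ⬝ᵥ y)) := by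
  intro e' he'
  obtain ⟨x', hx', y', hy', rfl⟩ := h.exists_eq_mk_point he'
  have hne := (h.ne_and_ne_neg_of_edge one_ne_zero hμ he').1
  rw [S.verts_eq]
  refine ⟨_, ⟨x', hx', rfl⟩, _, ⟨y', hy', rfl⟩, by rw [S.diamond_point, mul_one], ?_⟩
  rw [S.combLength_eq_level hμ hopp hx' hy' hne,
    h.dotProduct_eq_of_edges one_ne_zero hμ hx hx' he he']

end GeometricPolyhedron.HasTwoOrbits

/-- `P` is a regular polyhedron of index 2 whose vertices form two orbits under `G(P)`, namely the
vertex set of a Platonic solid `S` and that of `S^◇`, where `S^◇ = μ S` is the image of `S` under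
the homothety of ratio `μ` about the center of `S`; a negative ratio (`S^◇` opposed to `S`) is
allowed only for tetrahedra. -/
theorem lemma9 (P : GeometricPolyhedron) (hP : P.IsRegularOfIndexTwo)
    (S : PlatonicSolid) (μ : ℝ) (hμ : μ ≠ 0) (hopp : μ < 0 → S.kind = .tetrahedron)
    (hS : P.IsVertexOrbit S.verts) (hSd : P.IsVertexOrbit (S.diamond μ '' S.verts))
    (hne : S.verts ≠ S.diamond μ '' S.verts)
    (hV : P.verts = S.verts ∪ S.diamond μ '' S.verts) :
    S.kind ≠ .cube ∧
    (S.kind = .tetrahedron ∨ S.kind = .octahedron → P.HasEdgeLength S μ 1) ∧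
    (S.kind = .icosahedron → P.HasEdgeLength S μ 1 ∨ P.HasEdgeLength S μ 2) ∧
    (S.kind = .dodecahedron → P.HasEdgeLength S μ 1 ∨ P.HasEdgeLength S μ 4) ∧
    P.RotationsSimplyEdgeTransitive := by
  have h : P.HasTwoOrbits (S.point 1 '' S.kind.vecs) (S.point μ '' S.kind.vecs) := by
    rw [← S.verts_eq, ← S.image_diamond_verts]
    exact ⟨hP, hS, hSd, hne, hV⟩
  obtain ⟨x, hx, y, hy, he⟩ := h.exists_edge
  obtain ⟨hxy, hxy'⟩ := h.ne_and_ne_neg_of_edge one_ne_zero hμ he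
  have hlength := h.hasEdgeLength_level hμ hopp hx he
  obtain ⟨htetra_octa, hicosa, hdodeca⟩ := S.kind.level_dotProduct_of_ne x hx y hy hxy hxy'
  refine ⟨h.kind_ne_cube one_ne_zero hμ, fun hk => htetra_octa hk ▸ hlength, fun hk => ?_,
    fun hk => ?_, h.rotationsSimplyEdgeTransitive one_ne_zero hμ⟩
  · rcases hicosa hk with hl | hl
    exacts [.inl (hl ▸ hlength), .inr (hl ▸ hlength)]
  · rcases hdodeca hk (h.dotProduct_ne_of_kind_eq_dodecahedron one_ne_zero hμ hk hx hy he) with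
      hl | hl
    exacts [.inl (hl ▸ hlength), .inr (hl ▸ hlength)]
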